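/- For a group \(G\) and \(\varphi\in\mathrm{Aut}(G)\), call \(x,y\in G\) \(\varphi\)-conjugate if \(x=g\,y\,\varphi(g)^{-1}\) for some \(g\in G\). Let \(R(\varphi)\) be the number of \(\varphi\)-conjugacy classes and let \(\mathrm{Spec}_R(G)=\{R(\varphi)\mid\varphi\in\mathrm{Aut}(G)\}\). For positive integers \(a,b\), let \(D(a,b)\) be the set of all tuples of \(b\) pairwise coprime non-negative integers each dividing \(a\), and let \(D'(a,b)\) be the set of tuples in \(D(a,b)\) at least one of whose entries is divisible by \(3\). Write \(C_k\) for the cyclic group of order \(k\). **Theorem.** Let \(p\) be a prime and let \(n\ge 2\) and \(m\ge 0\) be integers with \(\gcd(n,p)=1\). Let \(G=(C_n\times C_{p^m})\rtimes C_p\) be a semidirect product in which \(C_p\) acts freely on \(C_n\) (no non-identity element of \(C_p\) fixes a non-identity element of \(C_n\)) and trivially on \(C_{p^m}\). 1. If \(p\) is odd and \(m=0\), then \[\mathrm{Spec}_R(G)=\Big\{p+\sum_{i=0}^{p-1}\frac{d_i-1}{p}\ \Big|\ (d_0,\dots,d_{p-1})\in D(n,p)\Big\}.\] 2. If \(p\)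 is odd and \(m\ge 1\), then \[\mathrm{Spec}_R(G)=\Big\{p^{e+1}+p^e\sum_{i=0}^{p-1}\frac{d_i-1}{p}\ \Big|\ 0\le e\le m,\ (d_0,\dots,d_{p-1})\in D(n,p)\Big\}\cup\Big\{p^m+p^m\sum_{i=0}^{p-1}\frac{d_i-1}{p}\ \Big|\ (d_0,\dots,d_{p-1})\in D(n,p)\Big\}.\] 3. If \(p=2\), \(m=0\) and \(3\nmid n\), then \[\mathrm{Spec}_R(G)=\Big\{2+\frac{d_0+d_1-2}{2}\ \Big|\ (d_0,d_1)\in D(n,2)\Big\}.\] 4. If \(p=2\), \(m\ge 1\) and \(3\nmid n\), then \[\mathrm{Spec}_R(G)=\Big\{2^{e+1}+2^e\cdot\frac{d_0+d_1-2}{2}\ \Big|\ 1\le e\le m,\ (d_0,d_1)\in D(n,2)\Big\}\cup\Big\{2^m+2^m\cdot\frac{d_0+d_1-2}{2}\ \Big|\ (d_0,d_1)\in D(n,2)\Big\}.\] 5. If \(p=2\) and \(3\mid n\), then the formulas of 3 (for \(m=0\)) and 4 (for \(m\ge1\)) hold with \(D(n,2)\) replaced by \(D'(n,2)\). Here \(e\)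 ranges over integers. -/

import Mathlib

/-- Two elements `x, y` of `G` are `φ`-conjugate if `x = g * y * (φ g)⁻¹` for some `g`. -/
def TwistedConj {G : Type*} [Group G] (φ : MulAut G) (x y : G) : Prop :=
  ∃ g : G, x = g * y * (φ g)⁻¹

/-- `φ`-conjugacy is an equivalence relation. -/
def twistedSetoid {G : Type*} [Group G] (φ : MulAut G) : Setoid G where
  r := TwistedConj φ
  iseqv :=
    { refl := fun x => ⟨1, by simp⟩
      symm := by
        rintro x y ⟨g, rfl⟩
        exact ⟨g⁻¹, by simp [mul_assoc]⟩
      trans := by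
        rintro x y z ⟨g, rfl⟩ ⟨h, rfl⟩
        exact ⟨g * h, by simp [mul_assoc]⟩ }

/-- The Reidemeister number `R(φ)`: the number of `φ`-conjugacy classes, possibly infinite. -/
noncomputable def reidemeisterNumber {G : Type*} [Group G] (φ : MulAut G) : ℕ∞ :=
  ENat.card (Quotient (twistedSetoid φ))

/-- The Reidemeister spectrum `Spec_R(G) = {R(φ) | φ ∈ Aut(G)}`. -/
def reidemeisterSpectrum (G : Type*) [Group G] : Set ℕ∞ :=
  {r | ∃ φ : MulAut G, reidemeisterNumber φ = r}

/-- The inclusion of `ℕ ∪ {∞}` into `ℚ ∪ {∞}`. It is used to compare a spectrum with a set of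
explicit rational expressions. -/
def natInftyToRat : ℕ∞ → WithTop ℚ := ENat.map (Nat.cast : ℕ → ℚ)

/-- The set `Spec_R(G)` consists of finite numbers, and these are exactly the members of `S`. -/
def SpectrumEq (G : Type*) [Group G] (S : Set ℚ) : Prop :=
  natInftyToRat '' reidemeisterSpectrum G = (fun x : ℚ => (x : WithTop ℚ)) '' S

/-- `D(a, b)`: tuples of `b` pairwise coprime non-negative divisors of `a`. -/
def coprimeDivisors (a b : ℕ) : Set (Fin b → ℕ) :=
  {d | (∀ i, d i ∣ a) ∧ ∀ i j, i ≠ j → Nat.gcd (d i) (d j) = 1}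

/-- `D'(a, b)`: the tuples in `D(a, b)` at least one entry of which is divisible by `3`. -/
def coprimeDivisorsThree (a b : ℕ) : Set (Fin b → ℕ) :=
  {d | d ∈ coprimeDivisors a b ∧ ∃ i, 3 ∣ d i}

/-! Write `G` as triples over `ZMod n`, `ZMod (p ^ m)`, `ZMod p`, the last factor acting on the
first through a character `ψ`; freeness means that `ψ c - 1` is a unit for `c ≠ 0`. Coprimality,
centrality and vanishing of the relevant cocycle classes force every automorphism to be given by
units `u`, `v`, a translation `k` and a homomorphism `β : ZMod p →+ ZMod (p ^ m)`
(`exists_eq_standardAut`).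

Burnside's lemma turns `R(φ)` into a count of pairs with `x * y = y * φ x`. Fibring over the `ZMod
p` components gives `card_classes_mul`, which involves only `d_i = gcd(n, 1 - ψ i * u)` and the
equations `(v - 1) * b + β j = 0`. Either these are all solvable, each with `p ^ e` solutions, and
`R * p = p ^ e * (∑ d_i + p * (p - 1))`; or `v = 1`, `β ≠ 0`, none is solvable for `j ≠ 0`, and `R *
p = p ^ m * ∑ d_i`. For `p = 2` and `m ≥ 1`, `v` is odd, which excludes `e = 0`.

It remains to find the tuples `(d_i)`. A prime `q ∣ n` divides `d_i` iff `ψ i * u = 1` mod `q`, and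
the `ψ i` are distinct mod `q`, so the `d_i` are pairwise coprime. Conversely `u` is built prime by
prime (`exists_local_multiplier`) and glued by the Chinese remainder theorem. The only obstruction
is a prime at which the `p` values `ψ i` fill all `q - 1` units, that is `p = 2`, `q = 3`. -/

/-! ### Reidemeister numbers of finite groups -/

/-- The number of twisted conjugacy classes of a finite group, as a rational number. -/
noncomputable def twistedClassCount {G : Type*} [Group G] (φ : MulAut G) : ℚ :=
  Nat.card (Quotient (twistedSetoid φ))

theorem natInftyToRat_reidemeisterNumber {G : Type*} [Group G] [Finite G] (φ : MulAut G) :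
    natInftyToRat (reidemeisterNumber φ) = ((twistedClassCount φ : ℚ) : WithTop ℚ) := by
  have : Finite (Quotient (twistedSetoid φ)) := Quotient.finite _
  rw [reidemeisterNumber, ENat.card_eq_coe_natCard, natInftyToRat, ENat.map_natCast, twistedClassCount]

theorem spectrumEq_iff {G : Type*} [Group G] [Finite G] (S : Set ℚ) :
    SpectrumEq G S ↔ Set.range (fun φ : MulAut G => twistedClassCount φ) = S := by
  have h : natInftyToRat '' reidemeisterSpectrum G =
      (fun x : ℚ => (x : WithTop ℚ)) '' Set.range (fun φ : MulAut G => twistedClassCount φ) := by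
    ext y
    constructor
    · rintro ⟨_, ⟨φ, rfl⟩, rfl⟩
      exact ⟨_, ⟨φ, rfl⟩, (natInftyToRat_reidemeisterNumber φ).symm⟩
    · rintro ⟨_, ⟨φ, rfl⟩, rfl⟩
      exact ⟨_, ⟨φ, rfl⟩, natInftyToRat_reidemeisterNumber φ⟩
  rw [SpectrumEq, h]
  exact (Set.image_injective.mpr fun a b hab => WithTop.coe_injective hab).eq_iff

theorem twistedClassCount_congr {G H : Type*} [Group G] [Group H] (e : G ≃* H) (φ : MulAut G) :
    twistedClassCount (MulAut.congr e φ) = twistedClassCount φ := by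
  unfold twistedClassCount
  congr 1
  symm
  refine Nat.card_congr (Quotient.congr e.toEquiv fun x y => ?_)
  constructor
  · rintro ⟨g, rfl⟩
    exact ⟨e g, by simp [MulAut.congr]⟩
  · rintro ⟨g, hg⟩
    refine ⟨e.symm g, e.injective ?_⟩
    simpa [MulAut.congr] using hg

theorem range_twistedClassCount_congr {G H : Type*} [Group G] [Group H] (e : G ≃* H) :
    Set.range (fun φ : MulAut G => twistedClassCount φ) =
      Set.range (fun φ : MulAut H => twistedClassCount φ) := by
  rw [← (MulAut.congr e).surjective.range_comp]
  congr 1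
  funext φ
  exact (twistedClassCount_congr e φ).symm

/-- A group with its action on itself by twisted conjugation. -/
def TwistedSpace {G : Type*} [Group G] (_φ : MulAut G) : Type _ := G

instance {G : Type*} [Group G] (φ : MulAut G) : MulAction G (TwistedSpace φ) where
  smul g := fun x : G => (g * x * (φ g)⁻¹ : G)
  one_smul := fun x : G => show (1 * x * (φ 1)⁻¹ : G) = x by simp
  mul_smul g h := fun x : G =>
    show (g * h * x * (φ (g * h))⁻¹ : G) = g * (h * x * (φ h)⁻¹) * (φ g)⁻¹ by simp [mul_assoc]

/-- Burnside's lemma for twisted conjugation: `g` fixes `x` exactly when `g * x = x * φ g`. -/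
theorem card_twistedClasses_mul_card {G : Type*} [Group G] [Finite G] (φ : MulAut G) :
    Nat.card (Quotient (twistedSetoid φ)) * Nat.card G =
      Nat.card {q : G × G // q.1 * q.2 = q.2 * φ q.1} := by
  have e₁ : Quotient (twistedSetoid φ) ≃
      Quotient (MulAction.orbitRel G (TwistedSpace φ)) :=
    Quotient.congr (Equiv.refl G) fun x y => by
      constructor
      · rintro ⟨g, hg⟩
        exact ⟨g, hg.symm⟩
      · rintro ⟨g, hg⟩
        exact ⟨g, hg.symm⟩
  have e₂ := MulAction.sigmaFixedByEquivOrbitsProdGroup G (TwistedSpace φ)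
  have e₃ : (Σ g : G, MulAction.fixedBy (TwistedSpace φ) g) ≃
      {q : G × G // q.1 * q.2 = q.2 * φ q.1} :=
    { toFun := fun s => ⟨(s.1, s.2.1), (mul_inv_eq_iff_eq_mul (G := G)).mp s.2.2⟩
      invFun := fun q => ⟨q.1.1, q.1.2, (mul_inv_eq_iff_eq_mul (G := G)).mpr q.2⟩
      left_inv := fun _ => rfl
      right_inv := fun _ => rfl }
  rw [← Nat.card_prod]
  exact Nat.card_congr ((e₁.prodCongr (Equiv.refl G)).trans (e₂.symm.trans e₃))

/-! ### A coordinate model and its commuting pairs -/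

/-- The group `(R × S) ⋊ T` in which `T` acts on `R` through `ψ` and trivially on `S`. -/
@[ext]
structure CharSemidirect {R S T : Type*} [CommRing R] [CommRing S] [CommRing T]
    (ψ : AddChar T R) where
  fst : R
  snd : S
  top : T

namespace CharSemidirect

variable {R S T : Type*} [CommRing R] [CommRing S] [CommRing T] {ψ : AddChar T R}

instance : Mul (CharSemidirect (S := S) ψ) :=
  ⟨fun x y => ⟨x.fst + ψ x.top * y.fst, x.snd + y.snd, x.top + y.top⟩⟩

instance : One (CharSemidirect (S := S) ψ) := ⟨⟨0, 0, 0⟩⟩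

instance : Inv (CharSemidirect (S := S) ψ) :=
  ⟨fun x => ⟨-(ψ (-x.top) * x.fst), -x.snd, -x.top⟩⟩

@[simp] theorem mul_fst (x y : CharSemidirect (S := S) ψ) :
    (x * y).fst = x.fst + ψ x.top * y.fst := rfl
@[simp] theorem mul_snd (x y : CharSemidirect (S := S) ψ) : (x * y).snd = x.snd + y.snd := rfl
@[simp] theorem mul_top (x y : CharSemidirect (S := S) ψ) : (x * y).top = x.top + y.top := rfl
@[simp] theorem one_fst : (1 : CharSemidirect (S := S) ψ).fst = 0 := rfl
@[simp] theorem one_snd : (1 : CharSemidirect (S := S) ψ).snd = 0 := rfl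
@[simp] theorem one_top : (1 : CharSemidirect (S := S) ψ).top = 0 := rfl
@[simp] theorem inv_fst (x : CharSemidirect (S := S) ψ) :
    x⁻¹.fst = -(ψ (-x.top) * x.fst) := rfl
@[simp] theorem inv_snd (x : CharSemidirect (S := S) ψ) : x⁻¹.snd = -x.snd := rfl
@[simp] theorem inv_top (x : CharSemidirect (S := S) ψ) : x⁻¹.top = -x.top := rfl

instance : Group (CharSemidirect (S := S) ψ) :=
  Group.ofLeftAxioms
    (fun x y z => by ext <;> simp [AddChar.map_add_eq_mul] <;> ring)
    (fun x => by ext <;> simp)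
    (fun x => by ext <;> simp)

/-- The elements of `CharSemidirect ψ` as triples. -/
def equivProd : CharSemidirect (S := S) ψ ≃ R × S × T where
  toFun x := (x.fst, x.snd, x.top)
  invFun q := ⟨q.1, q.2.1, q.2.2⟩
  left_inv _ := rfl
  right_inv _ := rfl

instance [Finite R] [Finite S] [Finite T] : Finite (CharSemidirect (S := S) ψ) :=
  Finite.of_equiv _ equivProd.symm

theorem card_eq : Nat.card (CharSemidirect (S := S) ψ) =
    Nat.card R * (Nat.card S * Nat.card T) := by
  rw [Nat.card_congr equivProd, Nat.card_prod, Nat.card_prod]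

/-- The automorphism of `CharSemidirect ψ` determined by units of `R` and `S`, a translation
parameter in `R` and an additive map `T → S`. -/
def standardAut (u : Rˣ) (k : R) (v : Sˣ) (β : T →+ S) : MulAut (CharSemidirect (S := S) ψ) where
  toFun x := ⟨u * x.fst + (ψ x.top - 1) * k, v * x.snd + β x.top, x.top⟩
  invFun x := ⟨↑u⁻¹ * (x.fst - (ψ x.top - 1) * k), ↑v⁻¹ * (x.snd - β x.top), x.top⟩
  left_inv x := by ext <;> simp
  right_inv x := by ext <;> simp
  map_mul' x y := by ext <;> simp [AddChar.map_add_eq_mul] <;> ring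

theorem commuting_iff (u : Rˣ) (k : R) (v : Sˣ) (β : T →+ S) (x y : CharSemidirect (S := S) ψ) :
    x * y = y * standardAut u k v β x ↔
      (1 - ψ y.top * u) * x.fst + (ψ x.top - 1) * (y.fst - ψ y.top * k) = 0 ∧
        (v - 1) * x.snd + β x.top = 0 := by
  rw [CharSemidirect.ext_iff]
  simp only [standardAut, mul_fst, mul_snd, mul_top, MulEquiv.coe_mk, Equiv.coe_fn_mk]
  rw [← sub_eq_zero, ← sub_eq_zero (a := x.snd + y.snd), ← neg_eq_zero (a := x.snd + y.snd - _)]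
  refine and_congr (Eq.congr_left (by ring)) ⟨fun h => ?_, fun h => ⟨?_, add_comm _ _⟩⟩
  · rw [← h.1]; ring
  · rw [← h]; ring

/-- The commuting pairs, fibred over their components in `T`. -/
def commutingEquiv (u : Rˣ) (k : R) (v : Sˣ) (β : T →+ S) :
    {q : CharSemidirect (S := S) ψ × CharSemidirect (S := S) ψ //
      q.1 * q.2 = q.2 * standardAut u k v β q.1} ≃
    Σ t : T × T, {a : R × R // (1 - ψ t.2 * u) * a.1 + (ψ t.1 - 1) * (a.2 - ψ t.2 * k) = 0} ×
      {b : S // (v - 1) * b + β t.1 = 0} × S where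
  toFun q := ⟨(q.1.1.top, q.1.2.top),
    ⟨(q.1.1.fst, q.1.2.fst), ((commuting_iff u k v β _ _).mp q.2).1⟩,
    ⟨q.1.1.snd, ((commuting_iff u k v β _ _).mp q.2).2⟩, q.1.2.snd⟩
  invFun s := ⟨(⟨s.2.1.1.1, s.2.2.1.1, s.1.1⟩, ⟨s.2.1.1.2, s.2.2.2, s.1.2⟩),
    (commuting_iff u k v β _ _).mpr ⟨s.2.1.2, s.2.2.1.2⟩⟩
  left_inv _ := rfl
  right_inv _ := rfl

theorem card_solutions_of_isUnit (r c : R) {t : R} (ht : IsUnit t) :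
    Nat.card {a : R × R // r * a.1 + t * (a.2 - c) = 0} = Nat.card R := by
  obtain ⟨t, rfl⟩ := ht
  refine Nat.card_congr
    { toFun := fun a => a.1.1
      invFun := fun x => ⟨(x, c - ↑t⁻¹ * (r * x)), by simp⟩
      left_inv := ?_
      right_inv := fun _ => rfl }
  rintro ⟨⟨x, y⟩, h⟩
  have h' : r * x = -(t * (y - c)) := eq_neg_of_add_eq_zero_left h
  ext
  · rfl
  · simp [h']

theorem card_solutions_zero (r c : R) :
    Nat.card {a : R × R // r * a.1 + 0 * (a.2 - c) = 0} =
      Nat.card {a : R // r * a = 0} * Nat.card R := by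
  rw [← Nat.card_prod]
  exact Nat.card_congr
    { toFun := fun a => (⟨a.1.1, by simpa using a.2⟩, a.1.2)
      invFun := fun a => ⟨(a.1.1, a.2), by simpa using a.1.2⟩
      left_inv := fun _ => rfl
      right_inv := fun _ => rfl }

/-- Commuting pairs are counted by the component `j` of `x` in `T`. For `j = 0` the `R`-equation
loses its second variable and leaves a kernel. For `j ≠ 0` the unit `ψ j - 1` lets the second
variable be solved for, so the `R`-count is `Nat.card R` whatever `u` and `k` are. -/
theorem card_classes_mul [Finite R] [Finite S] [Fintype T] [DecidableEq T]
    (hψ : ∀ c : T, c ≠ 0 → IsUnit (ψ c - 1))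
    (u : Rˣ) (k : R) (v : Sˣ) (β : T →+ S) :
    Nat.card (Quotient (twistedSetoid (standardAut (ψ := ψ) u k v β))) * Nat.card T =
      (∑ i : T, Nat.card {a : R // (1 - ψ i * u) * a = 0}) *
          Nat.card {b : S // ((v : S) - 1) * b = 0} +
        Nat.card T * ∑ j ∈ Finset.univ.erase (0 : T),
          Nat.card {b : S // ((v : S) - 1) * b + β j = 0} := by
  have h := card_twistedClasses_mul_card (standardAut (ψ := ψ) u k v β)
  rw [Nat.card_congr (commutingEquiv u k v β), Nat.card_sigma, Fintype.sum_prod_type,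
    ← Finset.add_sum_erase _ _ (Finset.mem_univ (0 : T)), card_eq] at h
  have h0 : ∀ i : T, Nat.card ({a : R × R // (1 - ψ i * u) * a.1 + (ψ 0 - 1) * (a.2 - ψ i * k) = 0} ×
      {b : S // ((v : S) - 1) * b + β 0 = 0} × S) =
      Nat.card {a : R // (1 - ψ i * u) * a = 0} * (Nat.card R *
        Nat.card {b : S // ((v : S) - 1) * b = 0} * Nat.card S) := by
    intro i
    simp only [AddChar.map_zero_eq_one, sub_self, map_zero, add_zero, Nat.card_prod,
      card_solutions_zero]
    ring
  have h1 : ∀ j ∈ Finset.univ.erase (0 : T), ∀ i : T,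
      Nat.card ({a : R × R // (1 - ψ i * u) * a.1 + (ψ j - 1) * (a.2 - ψ i * k) = 0} ×
      {b : S // ((v : S) - 1) * b + β j = 0} × S) =
      Nat.card R * Nat.card S * Nat.card {b : S // ((v : S) - 1) * b + β j = 0} := by
    intro j hj i
    rw [Nat.card_prod, Nat.card_prod,
      card_solutions_of_isUnit _ _ (hψ j (Finset.ne_of_mem_erase hj))]
    ring
  rw [Finset.sum_congr rfl fun i _ => h0 i,
    Finset.sum_congr rfl fun j hj => Finset.sum_congr rfl fun i _ => h1 j hj i] at h
  simp only [Finset.sum_const, Finset.card_univ, smul_eq_mul, ← Finset.mul_sum,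
    ← Finset.sum_mul, ← Nat.card_eq_fintype_card] at h
  have hR : 0 < Nat.card R := Nat.card_pos
  have hS : 0 < Nat.card S := Nat.card_pos
  refine Nat.eq_of_mul_eq_mul_left (Nat.mul_pos hR hS) ?_
  calc _ = _ := by ring
    _ = _ := h
    _ = _ := by ring

end CharSemidirect

/-! ### Automorphisms of the model -/

namespace CharSemidirect

variable {R S T : Type*} [CommRing R] [CommRing S] [CommRing T] {ψ : AddChar T R}

theorem pow_snd (x : CharSemidirect (S := S) ψ) (m : ℕ) : (x ^ m).snd = m * x.snd := by
  induction m with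
  | zero => simp
  | succ m ih => rw [pow_succ, mul_snd, ih]; push_cast; ring

theorem pow_top (x : CharSemidirect (S := S) ψ) (m : ℕ) : (x ^ m).top = m * x.top := by
  induction m with
  | zero => simp
  | succ m ih => rw [pow_succ, mul_top, ih]; push_cast; ring

theorem mk_fst_pow (a : R) (m : ℕ) :
    (⟨a, 0, 0⟩ : CharSemidirect (S := S) ψ) ^ m = ⟨m * a, 0, 0⟩ := by
  induction m with
  | zero => ext <;> simp
  | succ m ih => rw [pow_succ, ih]; ext <;> simp; ring

theorem mk_eq_mul (x : CharSemidirect (S := S) ψ) :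
    x = ⟨x.fst, 0, 0⟩ * (⟨0, x.snd, 0⟩ * ⟨0, 0, x.top⟩) := by
  ext <;> simp

end CharSemidirect

theorem ZMod.natCast_coprime_mul_eq_zero {n N : ℕ} (h : n.Coprime N) {x : ZMod N}
    (hx : (n : ZMod N) * x = 0) : x = 0 :=
  ((ZMod.isUnit_iff_coprime n N).mpr h).mul_right_eq_zero.mp hx

theorem ZMod.addMonoidHom_apply {n : ℕ} (f : ZMod n →+ ZMod n) (a : ZMod n) : f a = f 1 * a := by
  have h := (f.toZModLinearMap n).map_smul a 1
  simpa [mul_comm] using h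

theorem ZMod.isUnit_of_injective {n : ℕ} [NeZero n] {u : ZMod n}
    (h : ∀ a : ZMod n, u * a = 0 → a = 0) : IsUnit u := by
  have hi : Function.Injective (fun a : ZMod n => u * a) := fun a b hab =>
    sub_eq_zero.mp (h _ (by rw [mul_sub]; exact sub_eq_zero.mpr hab))
  obtain ⟨x, hx⟩ := Finite.surjective_of_injective hi 1
  exact IsUnit.of_mul_eq_one x hx

namespace CharSemidirect

variable {n N p : ℕ} {ψ : AddChar (ZMod p) (ZMod n)}

/-- The image is killed by `n`, which is coprime to the orders of the other two factors. -/
theorem map_mk_fst (hnN : n.Coprime N) (hnp : n.Coprime p)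
    (φ : MulAut (CharSemidirect (S := ZMod N) ψ)) (a : ZMod n) :
    φ ⟨a, 0, 0⟩ = ⟨(φ ⟨a, 0, 0⟩).fst, 0, 0⟩ := by
  have h : φ ⟨a, 0, 0⟩ ^ n = 1 := by
    rw [← map_pow, mk_fst_pow, CharP.cast_eq_zero, zero_mul]
    exact map_one φ
  ext
  · rfl
  · exact ZMod.natCast_coprime_mul_eq_zero hnN (by rw [← pow_snd, h, one_snd])
  · exact ZMod.natCast_coprime_mul_eq_zero hnp (by rw [← pow_top, h, one_top])

/-- The middle factor is central, hence so is its image. Commuting with `⟨1, 0, 0⟩` kills the top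
component, and commuting with `⟨0, 0, 1⟩` then kills the first. -/
theorem map_mk_snd [Fact (1 < n)] [Fact (1 < p)]
    (hψ : ∀ c : ZMod p, c ≠ 0 → IsUnit (ψ c - 1))
    (φ : MulAut (CharSemidirect (S := ZMod N) ψ)) (b : ZMod N) :
    φ ⟨0, b, 0⟩ = ⟨0, (φ ⟨0, b, 0⟩).snd, 0⟩ := by
  have hc : ∀ y, φ ⟨0, b, 0⟩ * y = y * φ ⟨0, b, 0⟩ := by
    intro y
    obtain ⟨x, rfl⟩ := φ.surjective y
    rw [← map_mul, ← map_mul]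
    congr 1
    ext <;> simp [add_comm]
  have htop : (φ ⟨0, b, 0⟩).top = 0 := by
    by_contra h
    have h1 := congrArg CharSemidirect.fst (hc ⟨1, 0, 0⟩)
    simp only [mul_fst, mul_one, AddChar.map_zero_eq_one, one_mul] at h1
    have h2 := hψ _ h
    rw [show ψ (φ ⟨0, b, 0⟩).top - 1 = 0 by linear_combination h1] at h2
    exact not_isUnit_zero h2
  ext
  · have h1 := congrArg CharSemidirect.fst (hc ⟨0, 0, 1⟩)
    simp only [mul_fst, mul_zero, add_zero, zero_add] at h1
    exact (hψ 1 one_ne_zero).mul_right_eq_zero.mp (by linear_combination -h1)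
  · rfl
  · exact htop

theorem exists_eq_standardAut [Fact (1 < n)] [Fact (1 < p)] [NeZero N]
    (hnN : n.Coprime N) (hnp : n.Coprime p)
    (hψ : ∀ c : ZMod p, c ≠ 0 → IsUnit (ψ c - 1))
    (φ : MulAut (CharSemidirect (S := ZMod N) ψ)) :
    ∃ (u : (ZMod n)ˣ) (k : ZMod n) (v : (ZMod N)ˣ) (β : ZMod p →+ ZMod N),
      φ = standardAut u k v β := by
  have : NeZero n := ⟨by have := (Fact.out : 1 < n); omega⟩
  have hfst := map_mk_fst hnN hnp φ
  have hsnd := map_mk_snd hψ φ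
  let f : ZMod n →+ ZMod n := AddMonoidHom.mk' (fun a => (φ ⟨a, 0, 0⟩).fst) fun a b => by
    have h : (⟨a + b, 0, 0⟩ : CharSemidirect (S := ZMod N) ψ) = ⟨a, 0, 0⟩ * ⟨b, 0, 0⟩ := by
      ext <;> simp
    rw [h, map_mul, hfst a, hfst b]
    simp
  let g : ZMod N →+ ZMod N := AddMonoidHom.mk' (fun b => (φ ⟨0, b, 0⟩).snd) fun a b => by
    have h : (⟨0, a + b, 0⟩ : CharSemidirect (S := ZMod N) ψ) = ⟨0, a, 0⟩ * ⟨0, b, 0⟩ := by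
      ext <;> simp
    rw [h, map_mul, mul_snd]
  have htop_mul : ∀ c d : ZMod p,
      (⟨0, 0, c + d⟩ : CharSemidirect (S := ZMod N) ψ) = ⟨0, 0, c⟩ * ⟨0, 0, d⟩ := by
    intro c d
    ext <;> simp
  let β : ZMod p →+ ZMod N := AddMonoidHom.mk' (fun c => (φ ⟨0, 0, c⟩).snd) fun c d => by
    rw [htop_mul, map_mul, mul_snd]
  have hf : ∀ a, φ ⟨a, 0, 0⟩ = ⟨f 1 * a, 0, 0⟩ := by
    intro a
    rw [← ZMod.addMonoidHom_apply f a]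
    exact hfst a
  have hg : ∀ b, φ ⟨0, b, 0⟩ = ⟨0, g 1 * b, 0⟩ := by
    intro b
    rw [← ZMod.addMonoidHom_apply g b]
    exact hsnd b
  have hu : IsUnit (f 1) := ZMod.isUnit_of_injective fun a ha => by
    have h : φ ⟨a, 0, 0⟩ = φ 1 := by rw [hf, ha, map_one]; rfl
    exact congrArg CharSemidirect.fst (φ.injective h)
  have hv : IsUnit (g 1) := ZMod.isUnit_of_injective fun a ha => by
    have h : φ ⟨0, a, 0⟩ = φ 1 := by rw [hg, ha, map_one]; rfl
    exact congrArg CharSemidirect.snd (φ.injective h)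
  obtain ⟨u, hu⟩ := hu
  obtain ⟨v, hv⟩ := hv
  -- `φ` commutes with scalars on the first factor, so `⟨0, 0, c⟩` and its image act on that factor
  -- by the same scalar; `ψ` is injective.
  have htop : ∀ c, (φ ⟨0, 0, c⟩).top = c := by
    intro c
    have h : (⟨0, 0, c⟩ * ⟨1, 0, 0⟩ : CharSemidirect (S := ZMod N) ψ) =
        ⟨ψ c, 0, 0⟩ * ⟨0, 0, c⟩ := by ext <;> simp
    have h1 := congrArg CharSemidirect.fst (congrArg φ h)
    rw [map_mul, map_mul, hf, hf, ← hu] at h1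
    simp only [mul_fst, mul_one, AddChar.map_zero_eq_one, one_mul] at h1
    have h2 : ψ (φ ⟨0, 0, c⟩).top = ψ c := by
      refine u.isUnit.mul_left_cancel ?_
      linear_combination h1
    by_contra hne
    have h3 := hψ _ (sub_ne_zero.mpr hne)
    have h4 : ψ ((φ ⟨0, 0, c⟩).top - c) = 1 := by
      rw [sub_eq_add_neg, AddChar.map_add_eq_mul, h2, ← AddChar.map_add_eq_mul, add_neg_cancel,
        AddChar.map_zero_eq_one]
    rw [h4, sub_self] at h3
    exact not_isUnit_zero h3
  obtain ⟨w, hw⟩ := hψ 1 one_ne_zero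
  -- The first component is a cocycle on `ZMod p`. It is a coboundary because the images of `c` and
  -- `1` commute and `ψ 1 - 1` is invertible.
  have hcocycle : ∀ c, (φ ⟨0, 0, c⟩).fst = (ψ c - 1) * (↑w⁻¹ * (φ ⟨0, 0, 1⟩).fst) := by
    intro c
    have h : φ ⟨0, 0, c⟩ * φ ⟨0, 0, 1⟩ = φ ⟨0, 0, 1⟩ * φ ⟨0, 0, c⟩ := by
      rw [← map_mul, ← map_mul, ← htop_mul, ← htop_mul, add_comm]
    have h1 := congrArg CharSemidirect.fst h
    rw [mul_fst, mul_fst, htop, htop] at h1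
    refine w.isUnit.mul_left_cancel ?_
    have h2 : (w : ZMod n) * ↑w⁻¹ = 1 := w.mul_inv
    rw [hw] at h2 ⊢
    linear_combination (-(ψ c - 1) * (φ ⟨0, 0, 1⟩).fst) * h2 - h1
  refine ⟨u, ↑w⁻¹ * (φ ⟨0, 0, 1⟩).fst, v, β, MulEquiv.ext fun x => ?_⟩
  conv_lhs => rw [mk_eq_mul x, map_mul, map_mul, hf, hg, ← hu, ← hv]
  ext
  · simpa [standardAut] using hcocycle x.top
  · simp [standardAut, β]
  · simpa [standardAut] using htop x.top

end CharSemidirect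

/-! ### Linear equations over `ZMod N` -/

theorem ZMod.card_mul_eq_zero {N : ℕ} [NeZero N] (r : ZMod N) :
    Nat.card {b : ZMod N // r * b = 0} = N.gcd r.val := by
  have h := IsCyclic.card_powMonoidHom_ker (G := Multiplicative (ZMod N)) r.val
  rw [Nat.card_congr Multiplicative.toAdd, Nat.card_zmod] at h
  rw [← h]
  refine Nat.card_congr (Multiplicative.ofAdd.subtypeEquiv fun b => ?_)
  rw [MonoidHom.mem_ker, powMonoidHom_apply, ← ofAdd_nsmul, ofAdd_eq_one, nsmul_eq_mul,
    ZMod.natCast_val, ZMod.cast_id]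

theorem ZMod.card_intCast_mul_eq_zero {N : ℕ} [NeZero N] (z : ℤ) :
    Nat.card {b : ZMod N // (z : ZMod N) * b = 0} = Int.gcd N z := by
  rw [ZMod.card_mul_eq_zero, ← Int.gcd_natCast_natCast, ZMod.val_intCast, Int.gcd_comm,
    Int.gcd_emod, Int.gcd_comm]

theorem Nat.card_mul_add_eq_zero {S : Type*} [CommRing S] (s t : S) (h : ∃ b, s * b + t = 0) :
    Nat.card {b : S // s * b + t = 0} = Nat.card {b : S // s * b = 0} := by
  obtain ⟨b₀, h₀⟩ := h
  refine Nat.card_congr ((Equiv.subRight b₀).subtypeEquiv fun b => ?_)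
  rw [Equiv.subRight_apply]
  exact ⟨fun h => by linear_combination h - h₀, fun h => by linear_combination h + h₀⟩

/-- The ideals of `ZMod (p ^ m)` form a chain, so every nonzero ideal contains the `p`-torsion.
Concretely `s` generates the ideal of some `p ^ f` with `f < m`, while `p ^ (m - 1)` divides `t`. -/
theorem ZMod.exists_mul_eq_of_prime_mul_eq_zero {p m : ℕ} [Fact p.Prime] {s t : ZMod (p ^ m)}
    (hs : s ≠ 0) (ht : (p : ZMod (p ^ m)) * t = 0) : ∃ b, s * b = t := by
  have hp : p.Prime := Fact.out
  obtain ⟨f, hf, hgcd⟩ := (Nat.dvd_prime_pow hp).mp (Nat.gcd_dvd_left (p ^ m) s.val)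
  have hlt : f < m := by
    refine lt_of_le_of_ne hf ?_
    rintro rfl
    refine hs ((ZMod.val_eq_zero s).mp (Nat.eq_zero_of_dvd_of_lt ?_ s.val_lt))
    exact Nat.gcd_eq_left_iff_dvd.mp hgcd
  have ht' : p ^ f ∣ t.val := by
    have h1 : p ^ m ∣ p * t.val := by
      rw [← ZMod.natCast_eq_zero_iff]
      simpa using ht
    obtain ⟨l, rfl⟩ : ∃ l, m = l + 1 := ⟨m - 1, by omega⟩
    exact (pow_dvd_pow p (by omega)).trans
      (Nat.dvd_of_mul_dvd_mul_left hp.pos ((dvd_of_eq (pow_succ' p l).symm).trans h1))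
  obtain ⟨y, hy⟩ := ht'
  -- Bézout writes `p ^ f` as a multiple of `s` modulo `p ^ m`.
  have hb := congrArg (Int.cast : ℤ → ZMod (p ^ m)) (Nat.gcd_eq_gcd_ab (p ^ m) s.val)
  rw [hgcd] at hb
  have h0 : (p : ZMod (p ^ m)) ^ m = 0 := by exact_mod_cast ZMod.natCast_self (p ^ m)
  push_cast at hb
  rw [h0, zero_mul, zero_add, ZMod.natCast_val, ZMod.cast_id] at hb
  refine ⟨(Nat.gcdB (p ^ m) s.val : ZMod (p ^ m)) * y, ?_⟩
  rw [← mul_assoc, ← hb]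
  have := congrArg (Nat.cast : ℕ → ZMod (p ^ m)) hy
  push_cast at this
  rw [← this, ZMod.natCast_val, ZMod.cast_id]

theorem ZMod.prime_mul_addMonoidHom {p N : ℕ} (β : ZMod p →+ ZMod N) (j : ZMod p) :
    (p : ZMod N) * β j = 0 := by
  rw [← nsmul_eq_mul, ← map_nsmul, nsmul_eq_mul, CharP.cast_eq_zero, zero_mul, map_zero]

theorem ZMod.addMonoidHom_eq_zero_of_apply_eq_zero {p : ℕ} [Fact p.Prime] {M : Type*}
    [AddCommGroup M] (β : ZMod p →+ M) {j : ZMod p} (hj : j ≠ 0) (h : β j = 0) : β = 0 := by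
  refine DFunLike.ext _ _ fun i => ?_
  have hi : i = (i * j⁻¹).val • j := by
    rw [nsmul_eq_mul, ZMod.natCast_val, ZMod.cast_id, mul_assoc, inv_mul_cancel₀ hj, mul_one]
  rw [hi, map_nsmul, h, smul_zero, AddMonoidHom.zero_apply]

theorem ZMod.eq_zero_or_eq_one_of_two : ∀ w : ZMod 2, w = 0 ∨ w = 1 := by decide

/-! ### Class counts that occur -/

/-- The order of the subgroup of fixed points of `a ↦ ψ i * u * a` on `ZMod n`. -/
noncomputable def fixedCount {n p : ℕ} (ψ : AddChar (ZMod p) (ZMod n)) (u : (ZMod n)ˣ)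
    (i : ZMod p) : ℕ :=
  Nat.card {a : ZMod n // (1 - ψ i * u) * a = 0}

namespace CharSemidirect

variable {n m p : ℕ} [Fact p.Prime] [NeZero n] {ψ : AddChar (ZMod p) (ZMod n)}

theorem card_classes_mul_of_solvable (hψ : ∀ c : ZMod p, c ≠ 0 → IsUnit (ψ c - 1))
    (u : (ZMod n)ˣ) (k : ZMod n) (v : (ZMod (p ^ m))ˣ) (β : ZMod p →+ ZMod (p ^ m))
    (hβ : ∀ j, ∃ b, ((v : ZMod (p ^ m)) - 1) * b + β j = 0) :
    Nat.card (Quotient (twistedSetoid (standardAut (ψ := ψ) u k v β))) * p =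
      Nat.card {b : ZMod (p ^ m) // ((v : ZMod (p ^ m)) - 1) * b = 0} *
        (∑ i, fixedCount ψ u i + p * (p - 1)) := by
  have h := card_classes_mul hψ u k v β
  rw [Finset.sum_congr rfl fun j _ => Nat.card_mul_add_eq_zero _ _ (hβ j), Finset.sum_const,
    Finset.card_erase_of_mem (Finset.mem_univ _), Finset.card_univ, ZMod.card, Nat.card_zmod,
    smul_eq_mul] at h
  rw [h]
  simp only [fixedCount]
  ring

theorem card_classes_mul_of_ne_zero (hψ : ∀ c : ZMod p, c ≠ 0 → IsUnit (ψ c - 1))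
    (u : (ZMod n)ˣ) (k : ZMod n) (β : ZMod p →+ ZMod (p ^ m)) (hβ : β ≠ 0) :
    Nat.card (Quotient (twistedSetoid (standardAut (ψ := ψ) u k 1 β))) * p =
      p ^ m * ∑ i, fixedCount ψ u i := by
  have h := card_classes_mul hψ u k 1 β
  rw [Finset.sum_eq_zero (s := Finset.univ.erase 0), mul_zero, add_zero, Nat.card_zmod] at h
  · rw [h, mul_comm]
    congr 1
    simp
  · intro j hj
    have : IsEmpty {b : ZMod (p ^ m) // (((1 : (ZMod (p ^ m))ˣ) : ZMod (p ^ m)) - 1) * b + β j = 0} :=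
      ⟨fun b => hβ (ZMod.addMonoidHom_eq_zero_of_apply_eq_zero β (Finset.ne_of_mem_erase hj)
        (by simpa using b.2))⟩
    exact Nat.card_of_isEmpty

/-- Values of `β` are `p`-torsion, so `v ≠ 1` makes all the equations solvable; failure forces `v =
1` and `β ≠ 0`, hence `1 ≤ m`. The bound on `e` is guarded by `1 ≤ m` because `m = 0` leaves only `e
= 0`. -/
theorem exists_card_classes_mul_eq [Fact (1 < n)] (hnp : n.Coprime p)
    (hψ : ∀ c : ZMod p, c ≠ 0 → IsUnit (ψ c - 1))
    (φ : MulAut (CharSemidirect (S := ZMod (p ^ m)) ψ)) :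
    ∃ u : (ZMod n)ˣ,
      (∃ e ≤ m, (p = 2 → 1 ≤ m → 1 ≤ e) ∧
        Nat.card (Quotient (twistedSetoid φ)) * p =
          p ^ e * (∑ i, fixedCount ψ u i + p * (p - 1))) ∨
      (1 ≤ m ∧ Nat.card (Quotient (twistedSetoid φ)) * p = p ^ m * ∑ i, fixedCount ψ u i) := by
  have hp : p.Prime := Fact.out
  have : Fact (1 < p) := ⟨hp.one_lt⟩
  obtain ⟨u, k, v, β, rfl⟩ := exists_eq_standardAut (hnp.pow_right m) hnp hψ φ
  refine ⟨u, ?_⟩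
  by_cases hβ : ∀ j, ∃ b, ((v : ZMod (p ^ m)) - 1) * b + β j = 0
  · left
    have h := card_classes_mul_of_solvable hψ u k v β hβ
    rw [ZMod.card_mul_eq_zero] at h
    obtain ⟨e, he, hgcd⟩ := (Nat.dvd_prime_pow hp).mp
      (Nat.gcd_dvd_left (p ^ m) ((v : ZMod (p ^ m)) - 1).val)
    rw [hgcd] at h
    refine ⟨e, he, ?_, h⟩
    rintro rfl hm
    by_contra he0
    obtain rfl : e = 0 := by omega
    have hcop : Nat.Coprime ((v : ZMod (2 ^ m)) - 1).val (2 ^ m) := by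
      rw [Nat.coprime_comm]; simpa using hgcd
    have h1 : IsUnit ((v : ZMod (2 ^ m)) - 1) := by
      have := (ZMod.isUnit_iff_coprime _ (2 ^ m)).mpr hcop
      rwa [ZMod.natCast_val, ZMod.cast_id] at this
    -- If `e = 0`, both `v` and `v - 1` would reduce to units of `ZMod 2`.
    have hdvd : 2 ∣ 2 ^ m := dvd_pow_self 2 (by omega)
    have h2 := h1.map (ZMod.castHom hdvd (ZMod 2))
    have h3 := v.isUnit.map (ZMod.castHom hdvd (ZMod 2))
    rw [map_sub, map_one] at h2
    generalize ZMod.castHom hdvd (ZMod 2) v = w at h2 h3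
    exact (ZMod.eq_zero_or_eq_one_of_two w).elim h3.ne_zero
      fun hw => h2.ne_zero (sub_eq_zero.mpr hw)
  · right
    have hv : (v : ZMod (p ^ m)) - 1 = 0 := by
      by_contra hv
      refine hβ fun j => ?_
      obtain ⟨b, hb⟩ := ZMod.exists_mul_eq_of_prime_mul_eq_zero hv (t := -β j)
        (by rw [mul_neg, ZMod.prime_mul_addMonoidHom, neg_zero])
      exact ⟨b, by rw [hb, neg_add_cancel]⟩
    obtain rfl : v = 1 := Units.ext (sub_eq_zero.mp hv)
    have hβ0 : β ≠ 0 := by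
      rintro rfl
      exact hβ fun j => ⟨0, by simp⟩
    refine ⟨?_, card_classes_mul_of_ne_zero hψ u k β hβ0⟩
    by_contra hm
    obtain rfl : m = 0 := by omega
    exact hβ0 (AddMonoidHom.ext fun _ => Subsingleton.elim (α := ZMod 1) _ _)

/-- The witness is `v = 1 + p ^ e` with `β = 0`. For `m ≥ 1` it fails to be a unit only when `p = 2`
and `e = 0`. -/
theorem exists_aut_card_classes_mul_eq (hψ : ∀ c : ZMod p, c ≠ 0 → IsUnit (ψ c - 1))
    (u : (ZMod n)ˣ) {e : ℕ} (he : e ≤ m) (hodd : p = 2 → 1 ≤ m → 1 ≤ e) :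
    ∃ φ : MulAut (CharSemidirect (S := ZMod (p ^ m)) ψ),
      Nat.card (Quotient (twistedSetoid φ)) * p =
        p ^ e * (∑ i, fixedCount ψ u i + p * (p - 1)) := by
  have hp : p.Prime := Fact.out
  have hcop : Nat.Coprime (1 + p ^ e) (p ^ m) := by
    rcases Nat.eq_zero_or_pos m with rfl | hm
    · simp
    refine Nat.Coprime.pow_right m ((Nat.Prime.coprime_iff_not_dvd hp).mpr fun hd => ?_).symm
    rcases Nat.eq_zero_or_pos e with rfl | he0
    · have h2 : p = 2 := (Nat.prime_dvd_prime_iff_eq hp Nat.prime_two).mp (by simpa using hd)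
      have := hodd h2 hm
      omega
    · exact hp.one_lt.ne' (Nat.dvd_one.mp
        ((Nat.dvd_add_left (dvd_pow_self p he0.ne')).mp hd))
  refine ⟨standardAut u 0 (ZMod.unitOfCoprime _ hcop) 0, ?_⟩
  rw [card_classes_mul_of_solvable hψ u 0 _ 0 fun j => ⟨0, by simp⟩]
  have h1 : ((ZMod.unitOfCoprime _ hcop : (ZMod (p ^ m))ˣ) : ZMod (p ^ m)) - 1 =
      ((p ^ e : ℕ) : ℤ) := by
    rw [ZMod.coe_unitOfCoprime]; push_cast; ring
  rw [h1, ZMod.card_intCast_mul_eq_zero, Int.gcd_natCast_natCast,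
    Nat.gcd_eq_right (pow_dvd_pow p he)]

/-- The witness is `v = 1` with `β` sending `1` to `p ^ (m - 1)`, a nonzero element of order `p`. -/
theorem exists_aut_card_classes_mul_eq' (hψ : ∀ c : ZMod p, c ≠ 0 → IsUnit (ψ c - 1))
    (u : (ZMod n)ˣ) (hm : 1 ≤ m) :
    ∃ φ : MulAut (CharSemidirect (S := ZMod (p ^ m)) ψ),
      Nat.card (Quotient (twistedSetoid φ)) * p = p ^ m * ∑ i, fixedCount ψ u i := by
  have hp : p.Prime := Fact.out
  let g : ℤ →+ ZMod (p ^ m) := zmultiplesHom _ ((p ^ (m - 1) : ℕ) : ZMod (p ^ m))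
  have hg : g p = 0 := by
    have : p * p ^ (m - 1) = p ^ m := by rw [← pow_succ']; congr 1; omega
    simp only [g, zmultiplesHom_apply, zsmul_eq_mul, Int.cast_natCast]
    rw [← Nat.cast_mul, this, ZMod.natCast_self]
  refine ⟨standardAut u 0 1 (ZMod.lift p ⟨g, hg⟩), card_classes_mul_of_ne_zero hψ u 0 _ ?_⟩
  intro h
  have h1 : ZMod.lift p ⟨g, hg⟩ ((1 : ℤ) : ZMod p) = 0 := by rw [h]; rfl
  rw [ZMod.lift_coe] at h1
  simp only [g, zmultiplesHom_apply, one_smul] at h1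
  rw [ZMod.natCast_eq_zero_iff] at h1
  have := (Nat.pow_dvd_pow_iff_le_right hp.one_lt).mp h1
  omega

end CharSemidirect

/-! ### Realisable tuples of fixed-point counts -/

theorem Nat.eq_of_gcd_ordProj_eq {n x y : ℕ} (hn : n ≠ 0) (hx : x ∣ n) (hy : y ∣ n)
    (h : ∀ q, q.Prime → q ∣ n →
      (q ^ n.factorization q).gcd x = (q ^ n.factorization q).gcd y) : x = y := by
  have key : ∀ {x y : ℕ}, x ∣ n → (∀ q, q.Prime → q ∣ n →
      (q ^ n.factorization q).gcd x = (q ^ n.factorization q).gcd y) → x ∣ y := by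
    intro x y hx h
    refine (Nat.dvd_iff_prime_pow_dvd_dvd _ _).mpr fun q e hq hqe => ?_
    rcases Nat.eq_zero_or_pos e with rfl | he
    · simp
    have hqn : q ∣ n := (dvd_pow_self q he.ne').trans (hqe.trans hx)
    have hle : e ≤ n.factorization q :=
      (hq.pow_dvd_iff_le_factorization hn).mp (hqe.trans hx)
    have h1 := Nat.dvd_gcd (pow_dvd_pow q hle) hqe
    rw [h q hq hqn] at h1
    exact h1.trans (Nat.gcd_dvd_right _ _)
  exact Nat.dvd_antisymm (key hx h) (key hy fun q hq hqn => (h q hq hqn).symm)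

theorem ZMod.natCast_val_eq_castHom {n q : ℕ} [NeZero n] (hq : q ∣ n) (r : ZMod n) :
    (r.val : ZMod q) = ZMod.castHom hq (ZMod q) r := by
  rw [ZMod.natCast_val, ZMod.castHom_apply]

theorem ZMod.mul_eq_one_of_three :
    ∀ a b : ZMod 3, a ≠ 1 → a ≠ 0 → b ≠ 0 → 1 * b = 1 ∨ a * b = 1 := by decide

section

variable {n p : ℕ} [NeZero n] {ψ : AddChar (ZMod p) (ZMod n)}

theorem fixedCount_eq_gcd (u : (ZMod n)ˣ) (i : ZMod p) :
    fixedCount ψ u i = n.gcd (1 - ψ i * u).val :=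
  ZMod.card_mul_eq_zero _

theorem fixedCount_dvd (u : (ZMod n)ˣ) (i : ZMod p) : fixedCount ψ u i ∣ n := by
  rw [fixedCount_eq_gcd]
  exact Nat.gcd_dvd_left _ _

theorem dvd_fixedCount_iff {q : ℕ} (hq : q ∣ n) (u : (ZMod n)ˣ) (i : ZMod p) :
    q ∣ fixedCount ψ u i ↔
      ZMod.castHom hq (ZMod q) (ψ i) * ZMod.castHom hq (ZMod q) u = 1 := by
  rw [fixedCount_eq_gcd, Nat.dvd_gcd_iff, and_iff_right hq, ← ZMod.natCast_eq_zero_iff,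
    ZMod.natCast_val_eq_castHom hq, map_sub, map_one, map_mul, sub_eq_zero, eq_comm]

omit [NeZero n] in
theorem castHom_addChar_injective (hψ : ∀ c : ZMod p, c ≠ 0 → IsUnit (ψ c - 1)) {q : ℕ}
    [Fact q.Prime] (hq : q ∣ n) : Function.Injective fun i => ZMod.castHom hq (ZMod q) (ψ i) := by
  intro i j hij
  by_contra hne
  have h := (hψ _ (sub_ne_zero.mpr hne)).map (ZMod.castHom hq (ZMod q))
  refine h.ne_zero ?_
  have h1 : ψ j * ψ (-j) = 1 := by
    rw [← AddChar.map_add_eq_mul, add_neg_cancel, AddChar.map_zero_eq_one]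
  rw [sub_eq_add_neg i j, AddChar.map_add_eq_mul, map_sub, map_mul,
    show ZMod.castHom hq (ZMod q) (ψ i) = ZMod.castHom hq (ZMod q) (ψ j) from hij, ← map_mul, h1,
    sub_self]

omit [NeZero n] in
theorem castHom_addChar_mul_neg {q : ℕ} (hq : q ∣ n) (i : ZMod p) :
    ZMod.castHom hq (ZMod q) (ψ i) * ZMod.castHom hq (ZMod q) (ψ (-i)) = 1 := by
  rw [← map_mul, ← AddChar.map_add_eq_mul, add_neg_cancel, AddChar.map_zero_eq_one, map_one]

theorem coprime_fixedCount (hψ : ∀ c : ZMod p, c ≠ 0 → IsUnit (ψ c - 1)) (u : (ZMod n)ˣ)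
    {i j : ZMod p} (hij : i ≠ j) : Nat.Coprime (fixedCount ψ u i) (fixedCount ψ u j) := by
  by_contra h
  obtain ⟨q, hq, hi, hj⟩ := Nat.Prime.not_coprime_iff_dvd.mp h
  have : Fact q.Prime := ⟨hq⟩
  have hqn : q ∣ n := hi.trans (fixedCount_dvd u i)
  rw [dvd_fixedCount_iff hqn] at hi hj
  have hu : ZMod.castHom hqn (ZMod q) u ≠ 0 := (u.isUnit.map _).ne_zero
  exact hij (castHom_addChar_injective hψ hqn (mul_right_cancel₀ hu (hi.trans hj.symm)))

/-- Modulo `3`, `ψ 0` and `ψ 1` are the two distinct units, so one of them is inverse to `u`. -/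
theorem exists_three_dvd_fixedCount {ψ : AddChar (ZMod 2) (ZMod n)}
    (hψ : ∀ c : ZMod 2, c ≠ 0 → IsUnit (ψ c - 1)) (hn : 3 ∣ n) (u : (ZMod n)ˣ) :
    ∃ i, 3 ∣ fixedCount ψ u i := by
  have : Fact (Nat.Prime 3) := ⟨Nat.prime_three⟩
  have h0 : ZMod.castHom hn (ZMod 3) (ψ 0) = 1 := by rw [AddChar.map_zero_eq_one, map_one]
  have h1 : ZMod.castHom hn (ZMod 3) (ψ 1) ≠ 1 := by
    rw [← h0]
    exact (castHom_addChar_injective hψ hn).ne one_ne_zero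
  have h2 : ZMod.castHom hn (ZMod 3) (ψ 1) ≠ 0 := left_ne_zero_of_mul_eq_one
    (castHom_addChar_mul_neg (ψ := ψ) hn 1)
  have hu : ZMod.castHom hn (ZMod 3) u ≠ 0 := (u.isUnit.map _).ne_zero
  rcases ZMod.mul_eq_one_of_three _ _ h1 h2 hu with h | h
  · exact ⟨0, (dvd_fixedCount_iff hn u 0).mpr (by rw [h0, h])⟩
  · exact ⟨1, (dvd_fixedCount_iff hn u 1).mpr h⟩

theorem Int.gcd_eq_of_dvd_sub {N z w : ℤ} (h : N ∣ z - w) : Int.gcd N z = Int.gcd N w := by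
  rw [Int.gcd_comm, Int.gcd_comm N, ← Int.gcd_emod z, ← Int.gcd_emod w,
    Int.emod_eq_emod_iff_emod_sub_eq_zero.mpr (Int.emod_eq_zero_of_dvd h)]

theorem exists_local_multiplier [Fact p.Prime] (hψ : ∀ c : ZMod p, c ≠ 0 → IsUnit (ψ c - 1))
    {d : ZMod p → ℕ} (hcop : ∀ i j, i ≠ j → Nat.Coprime (d i) (d j))
    (h3 : p = 2 → 3 ∣ n → ∃ i, 3 ∣ d i) {q k : ℕ} (hq : q.Prime) (hqn : q ∣ n)
    (hqk : q ^ k ∣ n) :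
    ∃ a : ℕ, ¬ q ∣ a ∧
      ∀ i, Int.gcd ((q ^ k : ℕ) : ℤ) (1 - (ψ i).val * a) = (q ^ k).gcd (d i) := by
  have : Fact q.Prime := ⟨hq⟩
  have hp : p.Prime := Fact.out
  have hinj := castHom_addChar_injective hψ hqn
  have hone : ∀ (i : ZMod p) (a : ℕ), ZMod.castHom hqn (ZMod q) (ψ i) * a ≠ 1 →
      ¬ q ∣ d i → Int.gcd ((q ^ k : ℕ) : ℤ) (1 - (ψ i).val * a) = (q ^ k).gcd (d i) := by
    intro i a ha hd
    rw [Nat.Coprime.pow_left k ((Nat.Prime.coprime_iff_not_dvd hq).mpr hd)]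
    refine Nat.Coprime.pow_left k ((Nat.Prime.coprime_iff_not_dvd hq).mpr fun h => ha ?_)
    rw [← Int.natCast_dvd, ← ZMod.intCast_zmod_eq_zero_iff_dvd] at h
    push_cast at h
    rw [ZMod.natCast_val_eq_castHom hqn] at h
    exact (sub_eq_zero.mp h).symm
  by_cases hd : ∃ i, q ∣ d i
  · obtain ⟨i₀, hi₀⟩ := hd
    -- With `a = ψ (-i₀) * (1 + d i₀)` one gets `1 - ψ i₀ * a = -d i₀` in `ZMod n`, the exact gcd at
    -- `i₀`. Modulo `q`, `a` is just `ψ (-i₀)`, so `ψ i * a ≠ 1` for `i ≠ i₀`.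
    have hcast : (((ψ (-i₀)).val * (1 + d i₀) : ℕ) : ZMod q) =
        ZMod.castHom hqn (ZMod q) (ψ (-i₀)) := by
      push_cast
      rw [ZMod.natCast_val_eq_castHom hqn, (ZMod.natCast_eq_zero_iff _ _).mpr hi₀, add_zero,
        mul_one]
    refine ⟨(ψ (-i₀)).val * (1 + d i₀), ?_, fun i => ?_⟩
    · rw [← ZMod.natCast_eq_zero_iff, hcast]
      exact right_ne_zero_of_mul_eq_one (castHom_addChar_mul_neg (ψ := ψ) hqn i₀)
    · by_cases hi : i = i₀
      · subst hi
        rw [Int.gcd_eq_of_dvd_sub (w := -(d i : ℤ)), Int.gcd_neg, Int.gcd_natCast_natCast]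
        refine (Int.natCast_dvd_natCast.mpr hqk).trans
          ((ZMod.intCast_zmod_eq_zero_iff_dvd _ n).mp ?_)
        have h1 : ψ i * ψ (-i) = 1 := by
          rw [← AddChar.map_add_eq_mul, add_neg_cancel, AddChar.map_zero_eq_one]
        push_cast
        rw [ZMod.natCast_val, ZMod.natCast_val, ZMod.cast_id, ZMod.cast_id]
        linear_combination (-(1 + (d i : ZMod n))) * h1
      · refine hone i _ ?_ fun h => ?_
        · rw [hcast]
          intro h
          refine hi (hinj (mul_right_cancel₀ (b := ZMod.castHom hqn (ZMod q) (ψ (-i₀))) ?_ ?_))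
          · exact right_ne_zero_of_mul_eq_one (castHom_addChar_mul_neg (ψ := ψ) hqn i₀)
          · exact h.trans (castHom_addChar_mul_neg (ψ := ψ) hqn i₀).symm
        · exact Nat.not_coprime_of_dvd_of_dvd hq.one_lt h hi₀ (hcop i i₀ hi)
  · push Not at hd
    -- Now `a` must be a unit mod `q` outside the set of values of `ψ`, which is closed under
    -- inverses.
    let f : ZMod p → ZMod q := fun i => ZMod.castHom hqn (ZMod q) (ψ i)
    have hf0 : (0 : ZMod q) ∉ Finset.univ.image f := by
      simp only [Finset.mem_image, Finset.mem_univ, true_and, not_exists]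
      exact fun i => left_ne_zero_of_mul_eq_one (castHom_addChar_mul_neg (ψ := ψ) hqn i)
    have hcard : (insert 0 (Finset.univ.image f)).card = p + 1 := by
      rw [Finset.card_insert_of_notMem hf0, Finset.card_image_of_injective _ hinj,
        Finset.card_univ, ZMod.card]
    have hle : p + 1 ≤ q := by
      rw [← hcard]
      exact (Finset.card_le_univ _).trans_eq (ZMod.card q)
    -- Consecutive primes are `2` and `3`, and then the hypothesis at `3` contradicts `hd`.
    have hne : p + 1 ≠ q := by
      rintro rfl
      have hp2 : p = 2 := by
        rcases hp.eq_two_or_odd' with h | h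
        · exact h
        · have h2 := hq.even_iff.mp (h.add_odd odd_one)
          have := hp.two_le
          omega
      subst hp2
      obtain ⟨i, hi⟩ := h3 rfl hqn
      exact hd i hi
    obtain ⟨x, hx⟩ : ∃ x, x ∉ insert 0 (Finset.univ.image f) := by
      by_contra! h
      have := Finset.eq_univ_of_forall h
      rw [this, Finset.card_univ, ZMod.card] at hcard
      exact hne hcard.symm
    rw [Finset.mem_insert, not_or] at hx
    have hxv : (x.val : ZMod q) = x := by rw [ZMod.natCast_val, ZMod.cast_id]
    refine ⟨x.val, ?_, fun i => hone i _ ?_ (hd i)⟩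
    · rw [← ZMod.natCast_eq_zero_iff, hxv]
      exact hx.1
    · rw [hxv]
      intro h
      refine hx.2 (Finset.mem_image.mpr ⟨-i, Finset.mem_univ _, ?_⟩)
      refine mul_left_cancel₀ (a := ZMod.castHom hqn (ZMod q) (ψ i)) ?_ ?_
      · exact left_ne_zero_of_mul_eq_one h
      · exact (castHom_addChar_mul_neg (ψ := ψ) hqn i).trans h.symm

theorem exists_fixedCount_eq [Fact p.Prime] (hψ : ∀ c : ZMod p, c ≠ 0 → IsUnit (ψ c - 1))
    {d : ZMod p → ℕ} (hd : ∀ i, d i ∣ n) (hcop : ∀ i j, i ≠ j → Nat.Coprime (d i) (d j))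
    (h3 : p = 2 → 3 ∣ n → ∃ i, 3 ∣ d i) :
    ∃ u : (ZMod n)ˣ, ∀ i, fixedCount ψ u i = d i := by
  have hn : n ≠ 0 := NeZero.ne n
  have hloc : ∀ q, ∃ a : ℕ, q ∈ n.primeFactors → ¬ q ∣ a ∧
      ∀ i, Int.gcd ((q ^ n.factorization q : ℕ) : ℤ) (1 - (ψ i).val * a) =
        (q ^ n.factorization q).gcd (d i) := by
    intro q
    by_cases hq : q ∈ n.primeFactors
    · obtain ⟨a, ha⟩ := exists_local_multiplier hψ hcop h3 (Nat.prime_of_mem_primeFactors hq)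
        (Nat.dvd_of_mem_primeFactors hq) (Nat.ordProj_dvd n q)
      exact ⟨a, fun _ => ha⟩
    · exact ⟨0, fun h => absurd h hq⟩
  choose a ha using hloc
  obtain ⟨x, hx⟩ := Nat.chineseRemainderOfFinset a (fun q => q ^ n.factorization q)
    n.primeFactors (fun q hq => pow_ne_zero _ (Nat.prime_of_mem_primeFactors hq).ne_zero)
    (fun q hq r hr hqr => Nat.coprime_pow_primes _ _ (Nat.prime_of_mem_primeFactors hq)
      (Nat.prime_of_mem_primeFactors hr) hqr)
  have hxn : Nat.Coprime x n := by
    by_contra h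
    obtain ⟨q, hq, hqx, hqn⟩ := Nat.Prime.not_coprime_iff_dvd.mp h
    have hmem : q ∈ n.primeFactors := Nat.mem_primeFactors.mpr ⟨hq, hqn, hn⟩
    have hk : n.factorization q ≠ 0 := (hq.factorization_pos_of_dvd hn hqn).ne'
    exact (ha q hmem).1 (((hx q hmem).dvd_iff (dvd_pow_self q hk)).mp hqx)
  refine ⟨ZMod.unitOfCoprime x hxn, fun i => ?_⟩
  have hz : (1 - ψ i * (ZMod.unitOfCoprime x hxn : (ZMod n)ˣ) : ZMod n) =
      ((1 - (ψ i).val * x : ℤ) : ZMod n) := by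
    push_cast
    rw [ZMod.natCast_val, ZMod.cast_id, ZMod.coe_unitOfCoprime]
  have hgcd : fixedCount ψ (ZMod.unitOfCoprime x hxn) i = Int.gcd n (1 - (ψ i).val * x) := by
    rw [fixedCount, hz, ZMod.card_intCast_mul_eq_zero]
  refine Nat.eq_of_gcd_ordProj_eq hn (fixedCount_dvd _ i) (hd i) fun q hq hqn => ?_
  have hmem : q ∈ n.primeFactors := Nat.mem_primeFactors.mpr ⟨hq, hqn, hn⟩
  rw [hgcd, ← (ha q hmem).2 i, Int.gcd_def, ← Nat.gcd_assoc, Int.natAbs_natCast,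
    Nat.gcd_eq_left (Nat.ordProj_dvd n q)]
  refine Int.gcd_eq_of_dvd_sub (N := ((q ^ n.factorization q : ℕ) : ℤ)) ?_
  have h := (Int.natCast_modEq_iff.mpr (hx q hmem)).dvd
  rw [show (1 - (ψ i).val * x : ℤ) - (1 - (ψ i).val * a q) = (ψ i).val * (a q - x) by ring]
  exact h.mul_left _

end

/-! ### From the abstract semidirect product to the model -/

theorem exists_mulEquiv_charSemidirect {n N p : ℕ} [NeZero n] (hnN : n.Coprime N)
    {A B C : Type*} [Group A] [Group B] [Group C] [IsCyclic A] [IsCyclic B] [IsCyclic C]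
    (hA : Nat.card A = n) (hB : Nat.card B = N) (hC : Nat.card C = p)
    (α : C →* MulAut (A × B))
    (hfree : ∀ c : C, c ≠ 1 → ∀ a : A, a ≠ 1 → α c (a, 1) ≠ (a, 1))
    (htriv : ∀ (c : C) (b : B), α c (1, b) = (1, b)) :
    ∃ ψ : AddChar (ZMod p) (ZMod n), (∀ c : ZMod p, c ≠ 0 → IsUnit (ψ c - 1)) ∧
      Nonempty ((A × B) ⋊[α] C ≃* CharSemidirect (S := ZMod N) ψ) := by
  let eA : A ≃* Multiplicative (ZMod n) := mulEquivOfCyclicCardEq (hA.trans (Nat.card_zmod n).symm)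
  let eB : B ≃* Multiplicative (ZMod N) := mulEquivOfCyclicCardEq (hB.trans (Nat.card_zmod N).symm)
  let eC : C ≃* Multiplicative (ZMod p) := mulEquivOfCyclicCardEq (hC.trans (Nat.card_zmod p).symm)
  have hsnd : ∀ c a, (α c (a, 1)).2 = 1 := by
    intro c a
    have h : α c (a, 1) ^ n = 1 := by
      rw [← map_pow, Prod.pow_mk, one_pow, ← hA, pow_card_eq_one']
      exact map_one _
    have h1 : orderOf (α c (a, 1)).2 ∣ n :=
      orderOf_dvd_of_pow_eq_one (by rw [← Prod.pow_snd, h, Prod.snd_one])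
    have h2 : orderOf (α c (a, 1)).2 ∣ N := hB ▸ orderOf_dvd_natCard _
    exact orderOf_eq_one_iff.mp (Nat.eq_one_of_dvd_coprimes hnN h1 h2)
  have hmk : ∀ c a b, α c (a, b) = ((α c (a, 1)).1, b) := by
    intro c a b
    have h : ((a, b) : A × B) = (a, 1) * (1, b) := by simp
    rw [h, map_mul, htriv]
    ext <;> simp [hsnd]
  let f : C → ZMod n →+ ZMod n := fun c => AddMonoidHom.mk'
    (fun x => (eA (α c (eA.symm (Multiplicative.ofAdd x), 1)).1).toAdd) fun x y => by
      rw [ofAdd_add, map_mul, ← toAdd_mul, ← map_mul eA, ← Prod.fst_mul, ← map_mul (α c),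
        Prod.mk_mul_mk, one_mul]
  have hf : ∀ c a, (eA (α c (a, 1)).1).toAdd = f c 1 * (eA a).toAdd := by
    intro c a
    rw [← ZMod.addMonoidHom_apply]
    simp [f]
  let ψ : AddChar (ZMod p) (ZMod n) :=
    { toFun := fun c => f (eC.symm (Multiplicative.ofAdd c)) 1
      map_zero_eq_one' := by simp [f]
      map_add_eq_mul' := fun c d => by
        set c' := eC.symm (Multiplicative.ofAdd c) with hc'
        set d' := eC.symm (Multiplicative.ofAdd d) with hd'
        -- The scalar of `c' * d'` is found by letting `c'` act on the image of the generator under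
        -- `d'`.
        have h := hf c' (α d' (eA.symm (Multiplicative.ofAdd 1), 1)).1
        rw [hf d', MulEquiv.apply_symm_apply, toAdd_ofAdd, mul_one] at h
        rw [← h, ofAdd_add, map_mul, ← hc', ← hd']
        change (eA (α (c' * d') _).1).toAdd = _
        rw [map_mul, MulAut.mul_apply, hmk d'] }
  have hψf : ∀ c, ψ (eC c).toAdd = f c 1 := by
    intro c
    change f (eC.symm (Multiplicative.ofAdd (eC c).toAdd)) 1 = f c 1
    simp
  refine ⟨ψ, fun c hc => ZMod.isUnit_of_injective fun x hx => ?_, ⟨?_⟩⟩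
  · by_contra hx0
    have hc' : eC.symm (Multiplicative.ofAdd c) ≠ 1 := by simpa using hc
    have ha' : eA.symm (Multiplicative.ofAdd x) ≠ 1 := by simpa using hx0
    refine hfree _ hc' _ ha' ?_
    rw [hmk]
    congr 1
    apply eA.injective
    apply Multiplicative.toAdd.injective
    rw [hf, MulEquiv.apply_symm_apply, toAdd_ofAdd]
    exact sub_eq_zero.mp (by rw [← hx, sub_mul, one_mul]; rfl)
  · exact
    { toFun := fun g => ⟨(eA g.left.1).toAdd, (eB g.left.2).toAdd, (eC g.right).toAdd⟩
      invFun := fun x => ⟨(eA.symm (Multiplicative.ofAdd x.fst),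
        eB.symm (Multiplicative.ofAdd x.snd)), eC.symm (Multiplicative.ofAdd x.top)⟩
      left_inv := fun g => by simp
      right_inv := fun x => by simp
      map_mul' := fun g h => by
        have h1 : α g.right h.left = ((α g.right (h.left.1, 1)).1, h.left.2) := hmk _ _ _
        ext
        · simp [h1, hf, hψf]
        · simp [h1]
        · simp }

/-- The tuples of orders `fixedCount ψ u` are exactly the tuples of pairwise coprime divisors of
`n`, subject to a condition at `3` when `p = 2`. -/
theorem exists_fixedCount_finEquiv_iff {n p : ℕ} [NeZero n] [Fact p.Prime]
    {ψ : AddChar (ZMod p) (ZMod n)} (hψ : ∀ c : ZMod p, c ≠ 0 → IsUnit (ψ c - 1))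
    (d : Fin p → ℕ) :
    (∃ u : (ZMod n)ˣ, ∀ i, fixedCount ψ u (ZMod.finEquiv p i) = d i) ↔
      d ∈ coprimeDivisors n p ∧ (p = 2 → 3 ∣ n → ∃ i, 3 ∣ d i) := by
  let e := ZMod.finEquiv p
  constructor
  · rintro ⟨u, hu⟩
    refine ⟨⟨fun i => hu i ▸ fixedCount_dvd u _, fun i j hij => ?_⟩, ?_⟩
    · rw [← hu, ← hu]
      exact coprime_fixedCount hψ u (e.injective.ne hij)
    · rintro rfl h3
      obtain ⟨i, hi⟩ := exists_three_dvd_fixedCount hψ h3 u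
      exact ⟨e.symm i, by rw [← hu]; simpa [e] using hi⟩
  · rintro ⟨⟨hd, hcop⟩, h3⟩
    obtain ⟨u, hu⟩ := exists_fixedCount_eq hψ (d := d ∘ e.symm) (fun i => hd _)
      (fun i j hij => hcop _ _ (e.symm.injective.ne hij)) (fun hp hn => by
        obtain ⟨i, hi⟩ := h3 hp hn
        exact ⟨e i, by simpa using hi⟩)
    exact ⟨u, fun i => by rw [hu]; simp [e]⟩

/-! ### Rational formulas and assembly -/

theorem eq_pow_succ_add_iff {p : ℕ} [Fact p.Prime] (d : Fin p → ℕ) (r e : ℕ) :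
    (r : ℚ) = (p : ℚ) ^ (e + 1) + (p : ℚ) ^ e * ∑ i, ((d i : ℚ) - 1) / p ↔
      r * p = p ^ e * (∑ i, d i + p * (p - 1)) := by
  have hp : p.Prime := Fact.out
  have hp0 : (p : ℚ) ≠ 0 := Nat.cast_ne_zero.mpr hp.ne_zero
  rw [← mul_left_inj' hp0, ← Finset.sum_div, Finset.sum_sub_distrib, Finset.sum_const,
    Finset.card_univ, Fintype.card_fin, ← Nat.cast_inj (R := ℚ)]
  -- The natural subtraction `p - 1` is not truncated, since `1 ≤ p`.
  push_cast [Nat.cast_sub hp.one_le]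
  refine Eq.congr_right ?_
  field_simp
  simp
  ring

theorem eq_pow_add_iff {p : ℕ} [Fact p.Prime] (d : Fin p → ℕ) (r m : ℕ) :
    (r : ℚ) = (p : ℚ) ^ m + (p : ℚ) ^ m * ∑ i, ((d i : ℚ) - 1) / p ↔
      r * p = p ^ m * ∑ i, d i := by
  have hp : p.Prime := Fact.out
  have hp0 : (p : ℚ) ≠ 0 := Nat.cast_ne_zero.mpr hp.ne_zero
  rw [← mul_left_inj' hp0, ← Finset.sum_div, Finset.sum_sub_distrib, Finset.sum_const,
    Finset.card_univ, Fintype.card_fin, ← Nat.cast_inj (R := ℚ)]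
  push_cast
  refine Eq.congr_right ?_
  field_simp
  simp

/-- A uniform description of which all the cases are specialisations: the conditions on `e` and on
divisibility by `3` are implications from `p = 2`, void for odd `p`. -/
theorem spectrumEq_semidirectProduct {n m p : ℕ} (hn : 2 ≤ n) (hp : p.Prime)
    (hnp : Nat.Coprime n p)
    {A B C : Type*} [Group A] [Group B] [Group C] [IsCyclic A] [IsCyclic B] [IsCyclic C]
    (hA : Nat.card A = n) (hB : Nat.card B = p ^ m) (hC : Nat.card C = p)
    (α : C →* MulAut (A × B))
    (hfree : ∀ c : C, c ≠ 1 → ∀ a : A, a ≠ 1 → α c (a, 1) ≠ (a, 1))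
    (htriv : ∀ (c : C) (b : B), α c (1, b) = (1, b)) :
    SpectrumEq ((A × B) ⋊[α] C)
      {x : ℚ | ∃ d : Fin p → ℕ,
        (d ∈ coprimeDivisors n p ∧ (p = 2 → 3 ∣ n → ∃ i, 3 ∣ d i)) ∧
        ((∃ e ≤ m, (p = 2 → 1 ≤ m → 1 ≤ e) ∧
          x = (p : ℚ) ^ (e + 1) + (p : ℚ) ^ e * ∑ i, ((d i : ℚ) - 1) / p) ∨
        (1 ≤ m ∧ x = (p : ℚ) ^ m + (p : ℚ) ^ m * ∑ i, ((d i : ℚ) - 1) / p))} := by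
  have : Fact p.Prime := ⟨hp⟩
  have : NeZero n := ⟨by omega⟩
  have : Fact (1 < n) := ⟨hn⟩
  obtain ⟨ψ, hψ, ⟨E⟩⟩ := exists_mulEquiv_charSemidirect (hnp.pow_right m) hA hB hC α hfree htriv
  have : Finite ((A × B) ⋊[α] C) := Finite.of_equiv _ E.symm.toEquiv
  rw [spectrumEq_iff, range_twistedClassCount_congr E]
  have hsum : ∀ (u : (ZMod n)ˣ) (d : Fin p → ℕ),
      (∀ i, fixedCount ψ u (ZMod.finEquiv p i) = d i) → ∑ i, fixedCount ψ u i = ∑ i, d i :=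
    fun u d hu => (Fintype.sum_equiv (ZMod.finEquiv p).toEquiv _ _ fun i => (hu i).symm).symm
  ext x
  constructor
  · rintro ⟨φ, rfl⟩
    obtain ⟨u, hu⟩ := CharSemidirect.exists_card_classes_mul_eq hnp hψ φ
    refine ⟨fun i => fixedCount ψ u (ZMod.finEquiv p i),
      (exists_fixedCount_finEquiv_iff hψ _).mp ⟨u, fun _ => rfl⟩, ?_⟩
    rw [hsum u _ fun _ => rfl] at hu
    rcases hu with ⟨e, he, he1, h⟩ | ⟨hm, h⟩
    · exact Or.inl ⟨e, he, he1, (eq_pow_succ_add_iff _ _ e).mpr h⟩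
    · exact Or.inr ⟨hm, (eq_pow_add_iff _ _ m).mpr h⟩
  · rintro ⟨d, hd, h⟩
    obtain ⟨u, hu⟩ := (exists_fixedCount_finEquiv_iff hψ d).mpr hd
    rcases h with ⟨e, he, he1, rfl⟩ | ⟨hm, rfl⟩
    · obtain ⟨φ, hφ⟩ := CharSemidirect.exists_aut_card_classes_mul_eq hψ u he he1
      rw [hsum u d hu] at hφ
      exact ⟨φ, (eq_pow_succ_add_iff _ _ e).mpr hφ⟩
    · obtain ⟨φ, hφ⟩ := CharSemidirect.exists_aut_card_classes_mul_eq' hψ u hm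
      rw [hsum u d hu] at hφ
      exact ⟨φ, (eq_pow_add_iff _ _ m).mpr hφ⟩

theorem mainTheorem1 (n m p : ℕ) (hn : 2 ≤ n) (hp : p.Prime) (hnp : Nat.Coprime n p)
    (A B C : Type*) [Group A] [Group B] [Group C] [IsCyclic A] [IsCyclic B] [IsCyclic C]
    (hA : Nat.card A = n) (hB : Nat.card B = p ^ m) (hC : Nat.card C = p)
    (α : C →* MulAut (A × B))
    (hfree : ∀ c : C, c ≠ 1 → ∀ a : A, a ≠ 1 → α c (a, 1) ≠ (a, 1))
    (htriv : ∀ (c : C) (b : B), α c (1, b) = (1, b)) :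
    (Odd p → m = 0 →
      SpectrumEq ((A × B) ⋊[α] C)
        {x : ℚ | ∃ d ∈ coprimeDivisors n p, x = p + ∑ i, ((d i : ℚ) - 1) / p}) ∧
    (Odd p → 1 ≤ m →
      SpectrumEq ((A × B) ⋊[α] C)
        ({x : ℚ | ∃ e : ℕ, 0 ≤ e ∧ e ≤ m ∧ ∃ d ∈ coprimeDivisors n p,
            x = (p : ℚ) ^ (e + 1) + (p : ℚ) ^ e * ∑ i, ((d i : ℚ) - 1) / p} ∪
         {x : ℚ | ∃ d ∈ coprimeDivisors n p,
            x = (p : ℚ) ^ m + (p : ℚ) ^ m * ∑ i, ((d i : ℚ) - 1) / p})) ∧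
    (p = 2 → m = 0 → ¬ 3 ∣ n →
      SpectrumEq ((A × B) ⋊[α] C)
        {x : ℚ | ∃ d ∈ coprimeDivisors n 2, x = 2 + ((d 0 : ℚ) + (d 1 : ℚ) - 2) / 2}) ∧
    (p = 2 → 1 ≤ m → ¬ 3 ∣ n →
      SpectrumEq ((A × B) ⋊[α] C)
        ({x : ℚ | ∃ e : ℕ, 1 ≤ e ∧ e ≤ m ∧ ∃ d ∈ coprimeDivisors n 2,
            x = (2 : ℚ) ^ (e + 1) + (2 : ℚ) ^ e * (((d 0 : ℚ) + (d 1 : ℚ) - 2) / 2)} ∪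
         {x : ℚ | ∃ d ∈ coprimeDivisors n 2,
            x = (2 : ℚ) ^ m + (2 : ℚ) ^ m * (((d 0 : ℚ) + (d 1 : ℚ) - 2) / 2)})) ∧
    (p = 2 → m = 0 → 3 ∣ n →
      SpectrumEq ((A × B) ⋊[α] C)
        {x : ℚ | ∃ d ∈ coprimeDivisorsThree n 2, x = 2 + ((d 0 : ℚ) + (d 1 : ℚ) - 2) / 2}) ∧
    (p = 2 → 1 ≤ m → 3 ∣ n →
      SpectrumEq ((A × B) ⋊[α] C)
        ({x : ℚ | ∃ e : ℕ, 1 ≤ e ∧ e ≤ m ∧ ∃ d ∈ coprimeDivisorsThree n 2,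
            x = (2 : ℚ) ^ (e + 1) + (2 : ℚ) ^ e * (((d 0 : ℚ) + (d 1 : ℚ) - 2) / 2)} ∪
         {x : ℚ | ∃ d ∈ coprimeDivisorsThree n 2,
            x = (2 : ℚ) ^ m + (2 : ℚ) ^ m * (((d 0 : ℚ) + (d 1 : ℚ) - 2) / 2)})) := by
  have key := spectrumEq_semidirectProduct hn hp hnp hA hB hC α hfree htriv
  have h2 : ∀ d : Fin 2 → ℕ, ∑ i, ((d i : ℚ) - 1) / 2 = ((d 0 : ℚ) + (d 1 : ℚ) - 2) / 2 := by
    intro d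
    rw [Fin.sum_univ_two]
    ring
  refine ⟨fun hodd hm => ?_, fun hodd hm => ?_, fun hp2 hm h3 => ?_, fun hp2 hm h3 => ?_,
    fun hp2 hm h3 => ?_, fun hp2 hm h3 => ?_⟩
  · have hp2 : p ≠ 2 := by rintro rfl; exact absurd hodd (by decide)
    convert key using 1
    ext x
    simp [hm, hp2]
  · have hp2 : p ≠ 2 := by rintro rfl; exact absurd hodd (by decide)
    convert key using 1
    ext x
    simp only [hp2, hm, Set.mem_union, Set.mem_ofPred_eq]
    clear key
    grind
  · subst hp2
    convert key using 1
    ext x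
    simp [hm, h3, h2]
  · subst hp2
    convert key using 1
    ext x
    simp only [h2, Set.mem_union, Set.mem_ofPred_eq, Nat.cast_ofNat]
    constructor
    · rintro (⟨e, he1, he, d, hd, hx⟩ | ⟨d, hd, hx⟩)
      · exact ⟨d, ⟨hd, fun _ h => absurd h h3⟩, Or.inl ⟨e, he, fun _ _ => he1, hx⟩⟩
      · exact ⟨d, ⟨hd, fun _ h => absurd h h3⟩, Or.inr ⟨hm, hx⟩⟩
    · rintro ⟨d, ⟨hd, -⟩, ⟨e, he, he1, hx⟩ | ⟨-, hx⟩⟩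
      · exact Or.inl ⟨e, he1 trivial hm, he, d, hd, hx⟩
      · exact Or.inr ⟨d, hd, hx⟩
  · subst hp2
    convert key using 1
    ext x
    simp [hm, h3, h2, coprimeDivisorsThree, and_assoc, and_or_left, or_and_right]
  · subst hp2
    convert key using 1
    ext x
    simp only [h2, Set.mem_union, Set.mem_ofPred_eq, Nat.cast_ofNat]
    constructor
    · rintro (⟨e, he1, he, d, hd, hx⟩ | ⟨d, hd, hx⟩)
      · exact ⟨d, ⟨hd.1, fun _ _ => hd.2⟩, Or.inl ⟨e, he, fun _ _ => he1, hx⟩⟩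
      · exact ⟨d, ⟨hd.1, fun _ _ => hd.2⟩, Or.inr ⟨hm, hx⟩⟩
    · rintro ⟨d, ⟨hd, hd3⟩, ⟨e, he, he1, hx⟩ | ⟨-, hx⟩⟩
      · exact Or.inl ⟨e, he1 trivial hm, he, d, ⟨hd, hd3 trivial h3⟩, hx⟩
      · exact Or.inr ⟨d, ⟨hd, hd3 trivial h3⟩, hx⟩
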